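/- **Proposition 2.2.** Let $\mathbb S^2\subset\mathbb R^3$ be the unit sphere with its surface measure $dn$, let $\Omega\subset\mathbb R^3$ be open, let $\mathbb R_+=[0,\infty)$, and let $K\in C(\mathbb S^2\times\mathbb S^2\times\Omega\times\mathbb R_+)$ be real-valued. For $(x,\nu)\in\Omega\times\mathbb R_+$ put $K_{x,\nu}(n,n')=K(n,n',x,\nu)$. Assume that for every $(x,\nu)\in\Omega\times\mathbb R_+$ the kernel $K_{x,\nu}$ is - invariant under rotations: $K_{x,\nu}(n,n')=K_{x,\nu}(\mathcal R n,\mathcal R n')$ for all $n,n'\in\mathbb S^2$ and $\mathcal R\in SO(3)$; - non-negative; - normalised: $\int_{\mathbb S^2}K_{x,\nu}(n,n')\,dn=1$ for all $n'\in\mathbb S^2$. For $\varphi\in L^\infty(\mathbb S^2)$ let $H_{x,\nu}[\varphi](n)=\int_{\mathbb S^2}K_{x,\nu}(n,n')\varphi(n')\,dn'$, a bounded linear operator on $L^\infty(\mathbb S^2)$, and for a function $\varphi$ of $(n,x,\nu)$ let $H[\varphi](n,x,\nu)=\int_{\mathbb S^2}K(n,n',x,\nu)\varphi(n',x,\nu)\,dn'$.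 Then the following holds. 1. For all $(x,\nu)\in\Omega\times\mathbb R_+$ and $n,\omega\in\mathbb S^2$ there are finitely many $n_1,\dots,n_N\in\mathbb S^2$, $N\ge 1$, such that, with $n_0=n$ and $n_{N+1}=\omega$, $K_{x,\nu}(n_{i-1},n_i)>0$ for all $i\in\{1,\dots,N+1\}$. 2. Fixed points of $H$ are continuous and constant in $n$ for each $(x,\nu)$. Precisely: - if $\varphi\in L^\infty(\mathbb S^2\times\Omega\times\mathbb R_+)$ (with respect to the product of surface and Lebesgue measure) satisfies $H[\varphi]=\varphi$ almost everywhere, then $\varphi$ agrees almost everywhere with a function $g$ such that $g(\cdot,x,\nu)$ is continuous and constant on $\mathbb S^2$ for every $(x,\nu)\in\Omega\times\mathbb R_+$; - if $\varphi$ is a function on $\mathbb S^2\times\Omega\times\mathbb R_+$ with $\varphi(\cdot,x,\nu)\in L^\infty(\mathbb S^2)$ for every $(x,\nu)$ and $H[\varphi]=\varphi$ everywhere, then $\varphi(\cdot,x,\nu)$ is itself continuous and constant for every $(x,\nu)$; - for every $(x,\nu)$, each $\varphi\in L^\infty(\mathbb S^2)$ with $H_{x,\nu}[\varphi]=\varphi$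 has a continuous representative, and that representative is constant. 3. For every $(x,\nu)\in\Omega\times\mathbb R_+$, $$\mathrm{Ran}(\mathrm{Id}-H_{x,\nu})=\Big\{\varphi\in L^\infty(\mathbb S^2):\ \int_{\mathbb S^2}\varphi(n)\,dn=0\Big\}.$$ -/

import Mathlib

open MeasureTheory
open scoped NNReal ENNReal

noncomputable section

namespace Scattering

/-- Euclidean three-space. -/
abbrev R3 : Type := EuclideanSpace ℝ (Fin 3)

/-- The unit sphere of three-space. -/
abbrev S2 : Type := Metric.sphere (0 : R3) 1

/-- The surface measure on the unit sphere (of total mass `4 * π`). -/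
def surf : Measure S2 := (volume : Measure R3).toSphere

instance : IsFiniteMeasure surf := by unfold surf; infer_instance

/-- The rotation `R ∈ SO(3)` acting on a unit vector. -/
def rotate (R : Matrix.specialOrthogonalGroup (Fin 3) ℝ) (n : S2) : S2 :=
  ⟨WithLp.toLp 2 ((R : Matrix (Fin 3) (Fin 3) ℝ).mulVec (n : R3).ofLp), by
    have hR : (R : Matrix (Fin 3) (Fin 3) ℝ).transpose * (R : Matrix (Fin 3) (Fin 3) ℝ) = 1 :=
      (Matrix.mem_orthogonalGroup_iff' (Fin 3) ℝ).1
        (Matrix.mem_specialOrthogonalGroup_iff.1 R.2).1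
    have hn : ‖(n : R3)‖ = 1 := mem_sphere_zero_iff_norm.1 n.2
    rw [mem_sphere_zero_iff_norm]
    refine Eq.trans ?_ hn
    rw [EuclideanSpace.norm_eq, EuclideanSpace.norm_eq]
    have key : ∀ v : Fin 3 → ℝ, ∑ i, ‖v i‖ ^ 2 = dotProduct v v := by
      intro v
      simp [dotProduct, sq]
    congr 1
    rw [key, key, Matrix.dotProduct_mulVec, Matrix.vecMul_mulVec, ← Matrix.dotProduct_mulVec, hR,
      Matrix.one_mulVec]⟩

/-- A kernel `k(n, n')` is invariant under rotations. -/
def RotationInvariant (k : C(S2 × S2, ℝ)) : Prop :=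
  ∀ (R : Matrix.specialOrthogonalGroup (Fin 3) ℝ) (n n' : S2),
    k (n, n') = k (rotate R n, rotate R n')

/-- A kernel is non-negative. -/
def NonNegative (k : C(S2 × S2, ℝ)) : Prop :=
  ∀ n n' : S2, 0 ≤ k (n, n')

/-- `∫ k(n, n') dn = 1` for every `n'`. -/
def Normalised (k : C(S2 × S2, ℝ)) : Prop :=
  ∀ n' : S2, ∫ n, k (n, n') ∂surf = 1

/-- `n` and `ω` are joined by a finite chain `n = m 0, m 1, …, m N, m (N + 1) = ω`, with `N ≥ 1`
intermediate directions, such that the kernel is positive at any two consecutive directions. -/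
def JoinedByChain (k : C(S2 × S2, ℝ)) (n ω : S2) : Prop :=
  ∃ (N : ℕ) (m : ℕ → S2), 1 ≤ N ∧ m 0 = n ∧ m (N + 1) = ω ∧
    ∀ i ∈ Finset.Icc 1 (N + 1), 0 < k (m (i - 1), m i)

/-- The scattering integral `n ↦ ∫ k(n, n') φ(n') dn'`. -/
def scatter (k : C(S2 × S2, ℝ)) (φ : S2 → ℝ) (n : S2) : ℝ :=
  ∫ n', k (n, n') * φ n' ∂surf

lemma integrable_scatter (k : C(S2 × S2, ℝ)) {φ : S2 → ℝ} (hφ : Integrable φ surf) (n : S2) :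
    Integrable (fun n' => k (n, n') * φ n') surf := by
  refine hφ.bdd_mul (c := ‖k‖) (Continuous.aestronglyMeasurable (by fun_prop)) ?_
  exact Filter.Eventually.of_forall fun n' => k.norm_coe_le_norm _

lemma continuous_scatter (k : C(S2 × S2, ℝ)) {φ : S2 → ℝ} (hφ : Integrable φ surf) :
    Continuous (scatter k φ) := by
  refine continuous_of_dominated (bound := fun n' => ‖k‖ * ‖φ n'‖)
    (fun n => (integrable_scatter k hφ n).aestronglyMeasurable) ?_ (hφ.norm.const_mul _) ?_
  · intro n
    refine Filter.Eventually.of_forall fun n' => ?_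
    rw [norm_mul]
    exact mul_le_mul_of_nonneg_right (k.norm_coe_le_norm _) (norm_nonneg _)
  · refine Filter.Eventually.of_forall fun n' => ?_
    fun_prop

lemma integrable_of_Linfty (φ : Lp ℝ ∞ surf) : Integrable φ surf :=
  (Lp.memLp φ).integrable le_top

lemma ae_norm_le (φ : Lp ℝ ∞ surf) : ∀ᵐ n ∂surf, ‖φ n‖ ≤ ‖φ‖ := by
  have h := ae_le_eLpNormEssSup (f := (φ : S2 → ℝ)) (μ := surf)
  filter_upwards [h] with n hn
  rw [Lp.norm_def, eLpNorm_exponent_top, ← toReal_enorm]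
  refine ENNReal.toReal_mono ?_ hn
  rw [← eLpNorm_exponent_top]
  exact (Lp.memLp φ).eLpNorm_ne_top

lemma norm_scatter_le (k : C(S2 × S2, ℝ)) (φ : Lp ℝ ∞ surf) (n : S2) :
    ‖scatter k φ n‖ ≤ ‖k‖ * surf.real Set.univ * ‖φ‖ := by
  have h : ‖∫ n', k (n, n') * φ n' ∂surf‖ ≤ (‖k‖ * ‖φ‖) * surf.real Set.univ := by
    refine norm_integral_le_of_norm_le_const ?_
    filter_upwards [ae_norm_le φ] with n' hn'
    rw [norm_mul]
    exact mul_le_mul (k.norm_coe_le_norm _) hn' (norm_nonneg _) (norm_nonneg _)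
  calc ‖scatter k φ n‖ ≤ (‖k‖ * ‖φ‖) * surf.real Set.univ := h
    _ = _ := by ring

lemma memLp_scatter (k : C(S2 × S2, ℝ)) (φ : Lp ℝ ∞ surf) : MemLp (scatter k φ) ∞ surf :=
  memLp_top_of_bound (continuous_scatter k (integrable_of_Linfty φ)).aestronglyMeasurable _
    (Filter.Eventually.of_forall (norm_scatter_le k φ))

/-- The scattering operator `H[φ] = ∫ k(·, n') φ(n') dn'`, a bounded linear operator from
`L^∞(S²)` to itself. -/
def scatteringOp (k : C(S2 × S2, ℝ)) : Lp ℝ ∞ surf →L[ℝ] Lp ℝ ∞ surf :=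
  LinearMap.mkContinuous
    { toFun := fun φ => (memLp_scatter k φ).toLp (scatter k φ)
      map_add' := by
        intro φ ψ
        rw [← MemLp.toLp_add]
        refine MemLp.toLp_congr _ _ (Filter.Eventually.of_forall fun n => ?_)
        rw [Pi.add_apply]
        unfold scatter
        rw [← integral_add (integrable_scatter k (integrable_of_Linfty φ) n)
          (integrable_scatter k (integrable_of_Linfty ψ) n)]
        refine integral_congr_ae ?_
        filter_upwards [Lp.coeFn_add φ ψ] with n' hn'
        rw [hn', Pi.add_apply, mul_add]
      map_smul' := by
        intro c φ
        rw [RingHom.id_apply, ← MemLp.toLp_const_smul]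
        refine MemLp.toLp_congr _ _ (Filter.Eventually.of_forall fun n => ?_)
        rw [Pi.smul_apply, smul_eq_mul]
        unfold scatter
        rw [← integral_const_mul]
        refine integral_congr_ae ?_
        filter_upwards [Lp.coeFn_smul c φ] with n' hn'
        rw [hn', Pi.smul_apply, smul_eq_mul]
        ring }
    (‖k‖ * surf.real Set.univ)
    (fun φ => by
      have h0 : 0 ≤ ‖k‖ * surf.real Set.univ * ‖φ‖ := by positivity
      change ‖(memLp_scatter k φ).toLp (scatter k φ)‖ ≤ _
      rw [Lp.norm_toLp]
      refine ENNReal.toReal_le_of_le_ofReal h0 ?_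
      rw [eLpNorm_exponent_top]
      refine eLpNormEssSup_le_of_ae_bound ?_
      exact Filter.Eventually.of_forall (norm_scatter_le k φ))

variable {Ω : Set R3}

/-- For a kernel `K(n, n', x, ν)` and a pair `(x, ν)`, the kernel `K_{x,ν}(n, n')`. -/
def slice (K : C(S2 × S2 × Ω × ℝ≥0, ℝ)) (x : Ω) (ν : ℝ≥0) : C(S2 × S2, ℝ) :=
  ⟨fun p => K (p.1, p.2, x, ν), by fun_prop⟩

/-- The product of the surface measure on the sphere with Lebesgue measure on `Ω × [0, ∞)`. -/
def prodMeasure (Ω : Set R3) : Measure (S2 × Ω × ℝ≥0) :=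
  surf.prod (((volume : Measure R3).comap ((↑) : Ω → R3)).prod
    ((volume : Measure ℝ).comap ((↑) : ℝ≥0 → ℝ)))

/-- The parametrised scattering operator
`H[φ](n, x, ν) = ∫ K(n, n', x, ν) φ(n', x, ν) dn'`. -/
def scatterFull (K : C(S2 × S2 × Ω × ℝ≥0, ℝ)) (φ : S2 × Ω × ℝ≥0 → ℝ) (p : S2 × Ω × ℝ≥0) : ℝ :=
  scatter (slice K p.2.1 p.2.2) (fun n' => φ (n', p.2.1, p.2.2)) p.1

end Scattering

end

open Scattering

open Scattering

namespace Scattering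

/-! A half-turn exchanges any two unit vectors, so a rotation-invariant kernel is symmetric
(`RotationInvariant.symm`) and hence normalised in both arguments. By symmetry and continuity, two
positive steps lead from a direction to every nearby one, so connectedness of the sphere makes any
two directions reachable from each other (`reflTransGen_pos`). Since `scatter` maps integrable
functions to continuous ones, every fixed point has a continuous representative; its maximum
propagates along chains of positivity, so it is constant (`const_of_continuous_fixed`).

For the range, `integral_scatter` gives the mean-zero condition. Conversely, replacing `k` by `k -
1` removes the constants from the kernel of `Id - H`, and the Fredholm alternative on continuous
functions applies (`exists_continuous_sub_scatter`). One application of `H` reduces bounded data to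
continuous data. -/

instance : surf.IsOpenPosMeasure := by unfold surf; infer_instance

lemma integrable_of_continuous {f : S2 → ℝ} (hf : Continuous f) : Integrable f surf :=
  hf.integrable_of_hasCompactSupport (HasCompactSupport.of_compactSpace f)

lemma surf_real_univ_pos : 0 < surf.real Set.univ := by
  rw [measureReal_def]
  refine ENNReal.toReal_pos ?_ (measure_ne_top _ _)
  rw [Measure.measure_univ_ne_zero]
  unfold surf
  exact Measure.toSphere_ne_zero _

lemma ae_eq_of_continuous {f g : S2 → ℝ} (hf : Continuous f) (hg : Continuous g)
    (h : f =ᵐ[surf] g) : f = g :=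
  (hf.ae_eq_iff_eq surf hg).1 h

lemma scatter_congr_ae (k : C(S2 × S2, ℝ)) {φ ψ : S2 → ℝ} (h : φ =ᵐ[surf] ψ) :
    scatter k φ = scatter k ψ := by
  funext n
  refine integral_congr_ae ?_
  filter_upwards [h] with n' hn'
  rw [hn']

/-! ### Half-turns and the symmetry of the kernel -/

section HalfTurn

/-- The matrix of the half-turn about the axis spanned by the unit vector `u`. -/
def halfTurnMatrix (u : Fin 3 → ℝ) : Matrix (Fin 3) (Fin 3) ℝ :=
  Matrix.of fun i j => 2 * u i * u j - if i = j then 1 else 0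

lemma halfTurnMatrix_mem {u : Fin 3 → ℝ} (hu : u 0 ^ 2 + u 1 ^ 2 + u 2 ^ 2 = 1) :
    halfTurnMatrix u ∈ Matrix.specialOrthogonalGroup (Fin 3) ℝ := by
  rw [Matrix.mem_specialOrthogonalGroup_iff]
  constructor
  · rw [Matrix.mem_orthogonalGroup_iff]
    ext i j
    have key : ∑ l, (halfTurnMatrix u i l) * (halfTurnMatrix u j l) =
        4 * u i * u j * (u 0 ^ 2 + u 1 ^ 2 + u 2 ^ 2 - 1) + if i = j then 1 else 0 := by
      fin_cases i <;> fin_cases j <;> simp [halfTurnMatrix, Fin.sum_univ_three] <;> ring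
    rw [Matrix.mul_apply]
    change ∑ l, halfTurnMatrix u i l * halfTurnMatrix u j l = _
    rw [key, hu, Matrix.one_apply]
    ring
  · rw [Matrix.det_fin_three]
    have key : ∀ a b c : ℝ, a ^ 2 + b ^ 2 + c ^ 2 = 1 →
        (2 * a * a - 1) * (2 * b * b - 1) * (2 * c * c - 1)
        - (2 * a * a - 1) * (2 * b * c) * (2 * c * b)
        - (2 * a * b) * (2 * b * a) * (2 * c * c - 1)
        + (2 * a * b) * (2 * b * c) * (2 * c * a)
        + (2 * a * c) * (2 * b * a) * (2 * c * b)
        - (2 * a * c) * (2 * b * b - 1) * (2 * c * a) = 1 := by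
      intro a b c h
      linear_combination 2 * h
    simpa [halfTurnMatrix] using key _ _ _ hu

lemma rotate_halfTurn_apply {u : Fin 3 → ℝ} (hu : u 0 ^ 2 + u 1 ^ 2 + u 2 ^ 2 = 1) (n : S2)
    (i : Fin 3) :
    (rotate ⟨halfTurnMatrix u, halfTurnMatrix_mem hu⟩ n : R3) i =
      2 * (u 0 * (n : R3) 0 + u 1 * (n : R3) 1 + u 2 * (n : R3) 2) * u i - (n : R3) i := by
  fin_cases i <;>
    simp [rotate, halfTurnMatrix, Matrix.mulVec, dotProduct, Fin.sum_univ_three] <;> ring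

lemma sq_sum_coord (n : S2) : (n : R3) 0 ^ 2 + (n : R3) 1 ^ 2 + (n : R3) 2 ^ 2 = 1 := by
  have h : ‖(n : R3)‖ = 1 := mem_sphere_zero_iff_norm.1 n.2
  have h2 := EuclideanSpace.real_norm_sq_eq (n : R3)
  rw [h, Fin.sum_univ_three] at h2
  linarith

lemma exists_unit_orthogonal (a b c : ℝ) :
    ∃ u : Fin 3 → ℝ, u 0 ^ 2 + u 1 ^ 2 + u 2 ^ 2 = 1 ∧ u 0 * a + u 1 * b + u 2 * c = 0 := by
  by_cases hab : a ^ 2 + b ^ 2 = 0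
  · have ha : a = 0 := by nlinarith [sq_nonneg a, sq_nonneg b]
    exact ⟨![1, 0, 0], by simp, by simp [ha]⟩
  · have hpos : 0 < a ^ 2 + b ^ 2 := lt_of_le_of_ne (by positivity) (Ne.symm hab)
    have hs : √(a ^ 2 + b ^ 2) ^ 2 = a ^ 2 + b ^ 2 := Real.sq_sqrt hpos.le
    have hs0 : √(a ^ 2 + b ^ 2) ≠ 0 := (Real.sqrt_pos.2 hpos).ne'
    refine ⟨![b / √(a ^ 2 + b ^ 2), -a / √(a ^ 2 + b ^ 2), 0], ?_, ?_⟩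
    · simp only [Matrix.cons_val_zero, Matrix.cons_val_one, Matrix.cons_val]
      rw [div_pow, div_pow, hs]
      field_simp
      ring
    · simp only [Matrix.cons_val_zero, Matrix.cons_val_one, Matrix.cons_val]
      field_simp
      ring

/-- Any two unit vectors are exchanged by a half-turn about their bisector. -/
lemma exists_rotate_swap (n m : S2) :
    ∃ R : Matrix.specialOrthogonalGroup (Fin 3) ℝ, rotate R n = m ∧ rotate R m = n := by
  have hn := sq_sum_coord n
  have hm := sq_sum_coord m
  -- The half-turn sends `v` to `2⟨u, v⟩u - v`, so both exchanges become equations with the same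
  -- right-hand side `n + m`.
  suffices h : ∃ u : Fin 3 → ℝ, u 0 ^ 2 + u 1 ^ 2 + u 2 ^ 2 = 1 ∧
      (∀ i, 2 * (u 0 * (n : R3) 0 + u 1 * (n : R3) 1 + u 2 * (n : R3) 2) * u i
        = (n : R3) i + (m : R3) i) ∧
      ∀ i, 2 * (u 0 * (m : R3) 0 + u 1 * (m : R3) 1 + u 2 * (m : R3) 2) * u i
        = (n : R3) i + (m : R3) i by
    obtain ⟨u, hu, h1, h2⟩ := h
    refine ⟨⟨halfTurnMatrix u, halfTurnMatrix_mem hu⟩, ?_, ?_⟩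
    · ext i
      rw [rotate_halfTurn_apply hu, h1]
      ring
    · ext i
      rw [rotate_halfTurn_apply hu, h2]
      ring
  set s : Fin 3 → ℝ := fun i => (n : R3) i + (m : R3) i with hs
  by_cases h0 : s 0 ^ 2 + s 1 ^ 2 + s 2 ^ 2 = 0
  -- Antipodal vectors have no bisector; any axis orthogonal to `n` serves.
  · obtain ⟨u, hu, hun⟩ := exists_unit_orthogonal ((n : R3) 0) ((n : R3) 1) ((n : R3) 2)
    have e0 : s 0 = 0 := by nlinarith [sq_nonneg (s 0), sq_nonneg (s 1), sq_nonneg (s 2)]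
    have e1 : s 1 = 0 := by nlinarith [sq_nonneg (s 0), sq_nonneg (s 1), sq_nonneg (s 2)]
    have e2 : s 2 = 0 := by nlinarith [sq_nonneg (s 0), sq_nonneg (s 1), sq_nonneg (s 2)]
    have hum : u 0 * (m : R3) 0 + u 1 * (m : R3) 1 + u 2 * (m : R3) 2 = 0 := by
      simp only [hs] at e0 e1 e2
      linear_combination u 0 * e0 + u 1 * e1 + u 2 * e2 - hun
    have hz : ∀ i, (n : R3) i + (m : R3) i = 0 := by
      intro i
      fin_cases i
      · exact e0
      · exact e1
      · exact e2
    refine ⟨u, hu, fun i => ?_, fun i => ?_⟩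
    · rw [hun, hz]; ring
    · rw [hum, hz]; ring
  · have hpos : 0 < s 0 ^ 2 + s 1 ^ 2 + s 2 ^ 2 :=
      lt_of_le_of_ne (by positivity) (Ne.symm h0)
    set r := √(s 0 ^ 2 + s 1 ^ 2 + s 2 ^ 2) with hr
    have hr2 : r ^ 2 = s 0 ^ 2 + s 1 ^ 2 + s 2 ^ 2 := Real.sq_sqrt hpos.le
    have hr0 : r ≠ 0 := (Real.sqrt_pos.2 hpos).ne'
    refine ⟨fun i => s i / r, ?_, fun i => ?_, fun i => ?_⟩
    · simp only [div_pow]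
      rw [hr2]
      field_simp
    · change _ = s i
      field_simp
      rw [hr2]
      simp only [hs]
      -- `2⟨s, n⟩ - |s|² = |n|² - |m|²` for `s = n + m`.
      linear_combination ((n : R3) i + (m : R3) i) * (hn - hm)
    · change _ = s i
      field_simp
      rw [hr2]
      simp only [hs]
      linear_combination ((n : R3) i + (m : R3) i) * (hm - hn)

end HalfTurn

lemma RotationInvariant.symm {k : C(S2 × S2, ℝ)} (h : RotationInvariant k) (n m : S2) :
    k (n, m) = k (m, n) := by
  obtain ⟨R, h1, h2⟩ := exists_rotate_swap n m
  rw [h R n m, h1, h2]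

/-! ### Chains of positivity, fixed points, conservation of the integral -/

section Kernel

variable {k : C(S2 × S2, ℝ)}

lemma integral_snd_eq_one (hrot : RotationInvariant k) (hnorm : Normalised k) (n : S2) :
    ∫ n', k (n, n') ∂surf = 1 := by
  refine Eq.trans ?_ (hnorm n)
  exact integral_congr_ae (Filter.Eventually.of_forall fun n' => hrot.symm n n')

lemma exists_pos (hrot : RotationInvariant k) (hnorm : Normalised k) (n : S2) :
    ∃ m, 0 < k (n, m) := by
  by_contra! h
  have h1 := integral_snd_eq_one hrot hnorm n
  have h2 : ∫ n', k (n, n') ∂surf ≤ 0 := integral_nonpos h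
  linarith

lemma reflTransGen_pos (hrot : RotationInvariant k) (hnorm : Normalised k) (n ω : S2) :
    Relation.ReflTransGen (fun a b => 0 < k (a, b)) n ω := by
  set r : S2 → S2 → Prop := fun a b => 0 < k (a, b) with hr
  have hsymm : ∀ a b, r a b → r b a := fun a b h => by
    simp only [hr] at h ⊢
    rwa [hrot.symm]
  -- Go from `a` to some `m` and back: `k (m, a) > 0` persists for `b` near `a`.
  have hnhds : ∀ a, ∀ᶠ b in nhds a, Relation.ReflTransGen r a b := by
    intro a
    obtain ⟨m, hm⟩ := exists_pos hrot hnorm a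
    have hopen : IsOpen {b | r m b} :=
      isOpen_lt continuous_const (by fun_prop)
    filter_upwards [hopen.mem_nhds (hsymm _ _ hm)] with b hb
    exact Relation.ReflTransGen.tail (r := r) (.single hm) hb
  have hsy : ∀ a b, Relation.ReflTransGen r a b → Relation.ReflTransGen r b a := by
    intro a b h
    induction h with
    | refl => exact .refl
    | tail _ h2 ih => exact .head (hsymm _ _ h2) ih
  have hrank : 1 < Module.rank ℝ R3 := by
    rw [rank_eq_card_basis (EuclideanSpace.basisFun (Fin 3) ℝ).toBasis]
    simp
  have : PreconnectedSpace S2 :=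
    isPreconnected_iff_preconnectedSpace.1 (isPreconnected_sphere hrank 0 1)
  have hclopen : IsClopen {b | Relation.ReflTransGen r n b} := by
    refine ⟨⟨?_⟩, ?_⟩
    · rw [isOpen_iff_mem_nhds]
      intro b hb
      filter_upwards [hnhds b] with c hc
      exact fun h => hb (Relation.ReflTransGen.trans h (hsy _ _ hc))
    · rw [isOpen_iff_mem_nhds]
      intro b hb
      filter_upwards [hnhds b] with c hc
      exact Relation.ReflTransGen.trans hb hc
  have huniv := hclopen.eq_univ ⟨n, Relation.ReflTransGen.refl⟩
  have hω := Set.mem_univ ω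
  rw [← huniv] at hω
  exact hω

lemma exists_chain {α : Type*} {r : α → α → Prop} {a b : α} (h : Relation.ReflTransGen r a b) :
    ∃ (N : ℕ) (m : ℕ → α), m 0 = a ∧ m N = b ∧ ∀ i < N, r (m i) (m (i + 1)) := by
  induction h with
  | refl => exact ⟨0, fun _ => a, rfl, rfl, by simp⟩
  | @tail b c _ hbc ih =>
    obtain ⟨N, m, h0, hN, hm⟩ := ih
    refine ⟨N + 1, fun i => if i ≤ N then m i else c, by simp [h0], by simp, fun i hi => ?_⟩
    rcases Nat.lt_succ_iff_lt_or_eq.1 hi with hi | rfl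
    · have : i + 1 ≤ N := hi
      simpa [hi.le, this] using hm i hi
    · simpa [hN] using hbc

lemma joinedByChain (hrot : RotationInvariant k) (hnorm : Normalised k) (n ω : S2) :
    JoinedByChain k n ω := by
  obtain ⟨p, hp⟩ := exists_pos hrot hnorm n
  have hp' : 0 < k (p, n) := by rwa [hrot.symm]
  obtain ⟨N, m, h0, hN, hm⟩ := exists_chain (reflTransGen_pos hrot hnorm n ω)
  -- The detour `n, p, n` put in front guarantees an intermediate direction even when the given
  -- chain has length `0` or `1`.
  let m' : ℕ → S2 := fun i => if i = 0 then n else if i = 1 then p else m (i - 2)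
  refine ⟨N + 1, m', by omega, rfl, by simpa [m'] using hN, fun i hi => ?_⟩
  rw [Finset.mem_Icc] at hi
  obtain ⟨j, rfl⟩ : ∃ j, i = j + 1 := ⟨i - 1, by omega⟩
  rcases j with _ | _ | j
  · simpa [m'] using hp
  · simpa [m', h0] using hp'
  · simpa [m'] using hm j (by omega)

/-- Strong maximum principle: continuous fixed points are constant. -/
lemma const_of_continuous_fixed (hrot : RotationInvariant k) (hpos : NonNegative k)
    (hnorm : Normalised k) {f : S2 → ℝ} (hf : Continuous f) (hfix : scatter k f = f) :
    ∃ c, ∀ n, f n = c := by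
  have : Nonempty S2 := (NormedSpace.sphere_nonempty.2 zero_le_one).to_subtype
  obtain ⟨n₀, -, hmax⟩ := isCompact_univ.exists_isMaxOn Set.univ_nonempty hf.continuousOn
  have hle : ∀ n, f n ≤ f n₀ := fun n => hmax (Set.mem_univ n)
  refine ⟨f n₀, fun ω => ?_⟩
  -- The chain is peeled from its start: the maximum passes from `a` to the next direction `b`.
  refine Relation.ReflTransGen.head_induction_on
    (motive := fun a _ => f a = f n₀ → f ω = f n₀) (reflTransGen_pos hrot hnorm n₀ ω)
    id ?_ rfl
  intro a b hab _ ih ha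
  refine ih ?_
  have hcont : Continuous fun n' => k (a, n') * (f n₀ - f n') := by fun_prop
  have hnn : 0 ≤ fun n' => k (a, n') * (f n₀ - f n') := fun n' =>
    mul_nonneg (hpos a n') (sub_nonneg.2 (hle n'))
  have hint : ∫ n', k (a, n') * (f n₀ - f n') ∂surf = 0 := by
    have h1 : ∫ n', k (a, n') * f n' ∂surf = f n₀ := by
      rw [← ha]; exact congrFun hfix a
    simp_rw [mul_sub]
    rw [integral_sub (integrable_of_continuous (by fun_prop))
      (integrable_of_continuous (by fun_prop)), integral_mul_const,
      integral_snd_eq_one hrot hnorm, h1]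
    ring
  -- Vanishing must hold at the given `b`, not just almost everywhere; continuity and the positivity
  -- of `surf` on open sets give this.
  have hzero := ae_eq_of_continuous hcont continuous_const
    ((integral_eq_zero_iff_of_nonneg hnn (integrable_of_continuous hcont)).1 hint)
  have := congrFun hzero b
  rcases mul_eq_zero.1 this with h | h
  · exact absurd h hab.ne'
  · linarith

/-- `scatter` depends only on the class of `f`, so `scatter k f` is an exact, continuous fixed
point. -/
lemma const_of_ae_fixed (hrot : RotationInvariant k) (hpos : NonNegative k)
    (hnorm : Normalised k) {f : S2 → ℝ} (hf : Integrable f surf) (hfix : f =ᵐ[surf] scatter k f) :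
    ∃ c, ∀ n, scatter k f n = c :=
  const_of_continuous_fixed hrot hpos hnorm (continuous_scatter k hf) (scatter_congr_ae k hfix).symm

/-- Fubini, with the normalisation applied to the inner integral over the first argument. -/
lemma integral_scatter (hnorm : Normalised k) {f : S2 → ℝ} (hf : Integrable f surf) :
    ∫ n, scatter k f n ∂surf = ∫ n, f n ∂surf := by
  have hint : Integrable (fun p : S2 × S2 => k p * f p.2) (surf.prod surf) := by
    refine (hf.comp_snd surf).bdd_mul (c := ‖k‖) k.continuous.aestronglyMeasurable ?_
    exact Filter.Eventually.of_forall fun p => k.norm_coe_le_norm _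
  unfold scatter
  rw [integral_integral_swap (f := fun n n' => k (n, n') * f n') hint]
  refine integral_congr_ae (Filter.Eventually.of_forall fun n' => ?_)
  simp only
  rw [integral_mul_const, hnorm, one_mul]

end Kernel

/-! ### Compactness and the Fredholm alternative on continuous functions -/

section Fredholm

open BoundedContinuousFunction

variable (k : C(S2 × S2, ℝ))

lemma norm_scatter_le_mul (φ : S2 →ᵇ ℝ) (n : S2) :
    ‖scatter k φ n‖ ≤ ‖k‖ * surf.real Set.univ * ‖φ‖ := by
  have h : ‖∫ n', k (n, n') * φ n' ∂surf‖ ≤ (‖k‖ * ‖φ‖) * surf.real Set.univ := by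
    refine norm_integral_le_of_norm_le_const (Filter.Eventually.of_forall fun n' => ?_)
    rw [norm_mul]
    exact mul_le_mul (k.norm_coe_le_norm _) (φ.norm_coe_le_norm _) (norm_nonneg _) (norm_nonneg _)
  calc ‖scatter k φ n‖ ≤ (‖k‖ * ‖φ‖) * surf.real Set.univ := h
    _ = _ := by ring

/-- The scattering operator on continuous functions. -/
noncomputable def scatterCont : (S2 →ᵇ ℝ) →L[ℝ] (S2 →ᵇ ℝ) :=
  LinearMap.mkContinuous
    { toFun := fun φ => mkOfCompact
        ⟨scatter k φ, continuous_scatter k (integrable_of_continuous φ.continuous)⟩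
      map_add' := fun φ ψ => by
        ext n
        have h := integral_add
          (integrable_scatter k (integrable_of_continuous φ.continuous) n)
          (integrable_scatter k (integrable_of_continuous ψ.continuous) n)
        simpa [scatter, mul_add] using h
      map_smul' := fun c φ => by
        ext n
        simp [scatter, ← integral_const_mul, mul_left_comm] }
    (‖k‖ * surf.real Set.univ)
    (fun φ => (norm_le (by positivity)).2 (norm_scatter_le_mul k φ))

@[simp]
lemma scatterCont_apply (φ : S2 →ᵇ ℝ) (n : S2) : scatterCont k φ n = scatter k φ n := rfl

lemma norm_scatter_sub_le (φ : S2 →ᵇ ℝ) (n m : S2) :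
    ‖scatter k φ n - scatter k φ m‖ ≤ ‖k.curry n - k.curry m‖ * ‖φ‖ * surf.real Set.univ := by
  have hφ := integrable_of_continuous φ.continuous
  unfold scatter
  rw [← integral_sub (integrable_scatter k hφ n) (integrable_scatter k hφ m)]
  refine norm_integral_le_of_norm_le_const (Filter.Eventually.of_forall fun n' => ?_)
  rw [← sub_mul, norm_mul]
  exact mul_le_mul ((k.curry n - k.curry m).norm_coe_le_norm n') (φ.norm_coe_le_norm _)
    (norm_nonneg _) (norm_nonneg _)

/-- Arzelà–Ascoli: `n ↦ k.curry n` is continuous in sup norm, which makes the image of the unit ball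
equicontinuous. -/
lemma isCompactOperator_scatterCont : IsCompactOperator (scatterCont k) := by
  refine (isCompactOperator_iff_isCompact_closure_image_closedBall
    (scatterCont k : (S2 →ᵇ ℝ) →ₗ[ℝ] (S2 →ᵇ ℝ)) one_pos).2 ?_
  refine arzela_ascoli (Metric.closedBall 0 (‖k‖ * surf.real Set.univ))
    (isCompact_closedBall _ _) _ ?_ ?_
  · rintro _ n ⟨φ, hφ, rfl⟩
    rw [mem_closedBall_zero_iff] at hφ ⊢
    refine (norm_scatter_le_mul k φ n).trans ?_
    exact mul_le_of_le_one_right (by positivity) hφ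
  · intro n₀
    rw [Metric.equicontinuousAt_iff_right]
    intro ε hε
    have hlim : Filter.Tendsto (fun n => ‖k.curry n₀ - k.curry n‖ * surf.real Set.univ)
        (nhds n₀) (nhds 0) := by
      have : Continuous fun n => ‖k.curry n₀ - k.curry n‖ * surf.real Set.univ := by fun_prop
      simpa using this.tendsto n₀
    filter_upwards [hlim.eventually_lt_const hε] with n hn
    rintro ⟨_, φ, hφ, rfl⟩
    rw [mem_closedBall_zero_iff] at hφ
    rw [dist_eq_norm]
    refine (norm_scatter_sub_le k φ n₀ n).trans_lt (lt_of_le_of_lt ?_ hn)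
    refine mul_le_mul_of_nonneg_right ?_ measureReal_nonneg
    exact mul_le_of_le_one_right (norm_nonneg _) hφ

/-- Fredholm alternative for the integral equation `χ - ∫ k(·, n') χ(n') dn' = f`. -/
lemma exists_sub_scatter_eq
    (hinj : ∀ χ : S2 → ℝ, Continuous χ → scatter k χ = χ → ∀ n, χ n = 0)
    {f : S2 → ℝ} (hf : Continuous f) :
    ∃ χ : S2 → ℝ, Continuous χ ∧ ∀ n, χ n - scatter k χ n = f n := by
  rcases (isCompactOperator_scatterCont k).hasEigenvalue_or_mem_resolventSet one_ne_zero with h | h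
  · obtain ⟨χ, hχ⟩ := h.exists_hasEigenvector
    refine absurd ?_ hχ.2
    ext n
    refine hinj χ χ.continuous ?_ n
    funext m
    have := congrArg (fun g : S2 →ᵇ ℝ => g m) hχ.apply_eq_smul
    simpa using this
  · rw [spectrum.mem_resolventSet_iff, map_one] at h
    obtain ⟨u, hu⟩ := h
    refine ⟨(↑u⁻¹ : (S2 →ᵇ ℝ) →L[ℝ] (S2 →ᵇ ℝ)) (mkOfCompact ⟨f, hf⟩),
      BoundedContinuousFunction.continuous _, fun n => ?_⟩
    have h1 : (u : (S2 →ᵇ ℝ) →L[ℝ] (S2 →ᵇ ℝ)) ((↑u⁻¹ : (S2 →ᵇ ℝ) →L[ℝ] (S2 →ᵇ ℝ))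
        (mkOfCompact ⟨f, hf⟩)) = mkOfCompact ⟨f, hf⟩ := by
      rw [← mul_apply_eq_comp, Units.mul_inv, one_apply_eq_self]
    rw [hu] at h1
    exact congrArg (fun g : S2 →ᵇ ℝ => g n) h1

end Fredholm

/-! ### The range of `Id - H` -/

section Range

variable {k : C(S2 × S2, ℝ)}

lemma exists_continuous_sub_scatter (hrot : RotationInvariant k) (hpos : NonNegative k)
    (hnorm : Normalised k) {f : S2 → ℝ} (hf : Continuous f) (hf0 : ∫ n, f n ∂surf = 0) :
    ∃ χ : S2 → ℝ, Continuous χ ∧ ∀ n, χ n - scatter k χ n = f n := by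
  have hsub : ∀ χ : S2 → ℝ, Continuous χ → ∀ n,
      scatter (k - 1) χ n = scatter k χ n - ∫ m, χ m ∂surf := by
    intro χ hχ n
    unfold scatter
    rw [← integral_sub (integrable_of_continuous (by fun_prop)) (integrable_of_continuous hχ)]
    simp [sub_mul]
  -- a solution of the equation for the kernel `k - 1` with mean-zero right-hand side has mean zero
  have hmean : ∀ χ g : S2 → ℝ, Continuous χ → ∫ n, g n ∂surf = 0 →
      (∀ n, χ n - scatter (k - 1) χ n = g n) → ∫ n, χ n ∂surf = 0 := by
    intro χ g hχ hg h
    have hχi := integrable_of_continuous hχ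
    have hsc := integrable_of_continuous (continuous_scatter k hχi)
    -- The part `χ - Hχ` integrates to zero, leaving the total mass of `surf` times `∫ χ`.
    have h1 : ∫ n, (χ n - scatter k χ n + ∫ m, χ m ∂surf) ∂surf = 0 := by
      rw [← hg]
      refine integral_congr_ae (Filter.Eventually.of_forall fun n => ?_)
      simp only
      rw [← h n, hsub χ hχ]
      ring
    rw [integral_add (f := fun n => χ n - scatter k χ n) (hχi.sub hsc) (integrable_const _),
      integral_sub hχi hsc,
      integral_scatter hnorm hχi, integral_const, sub_self, zero_add, smul_eq_mul] at h1
    exact (mul_eq_zero.1 h1).resolve_left surf_real_univ_pos.ne'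
  obtain ⟨χ, hχ, h⟩ := exists_sub_scatter_eq (k - 1) (fun χ hχ hfix => by
    have h0 : ∫ n, χ n ∂surf = 0 :=
      hmean χ (fun _ => 0) hχ (by simp) fun n => by rw [hfix, sub_self]
    have hfix' : scatter k χ = χ := by
      funext n
      have := congrFun hfix n
      rw [hsub χ hχ, h0, sub_zero] at this
      exact this
    obtain ⟨c, hc⟩ := const_of_continuous_fixed hrot hpos hnorm hχ hfix'
    simp_rw [hc] at h0 ⊢
    rw [integral_const, smul_eq_mul] at h0
    exact fun _ => (mul_eq_zero.1 h0).resolve_left surf_real_univ_pos.ne') hf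
  refine ⟨χ, hχ, fun n => ?_⟩
  rw [← h n, hsub χ hχ, hmean χ f hχ hf0 h, sub_zero]

lemma coeFn_scatteringOp (k : C(S2 × S2, ℝ)) (φ : Lp ℝ ∞ surf) :
    scatteringOp k φ =ᵐ[surf] scatter k φ :=
  (memLp_scatter k φ).coeFn_toLp

lemma range_sub_scatteringOp (hrot : RotationInvariant k) (hpos : NonNegative k)
    (hnorm : Normalised k) :
    Set.range (fun ψ : Lp ℝ ∞ surf => ψ - scatteringOp k ψ) =
      {φ : Lp ℝ ∞ surf | ∫ n, φ n ∂surf = 0} := by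
  ext φ
  constructor
  · rintro ⟨ψ, rfl⟩
    have hψ := integrable_of_Linfty ψ
    have hae : (ψ - scatteringOp k ψ : Lp ℝ ∞ surf) =ᵐ[surf] fun n => ψ n - scatter k ψ n := by
      filter_upwards [Lp.coeFn_sub ψ (scatteringOp k ψ), coeFn_scatteringOp k ψ] with n h1 h2
      rw [h1, Pi.sub_apply, h2]
    rw [Set.mem_ofPred_eq, integral_congr_ae hae,
      integral_sub hψ (integrable_of_continuous (continuous_scatter k hψ)),
      integral_scatter hnorm hψ, sub_self]
  · intro hφ
    have hφi := integrable_of_Linfty φ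
    obtain ⟨χ, hχ, h⟩ := exists_continuous_sub_scatter hrot hpos hnorm
      (continuous_scatter k hφi) ((integral_scatter hnorm hφi).trans hφ)
    have hχm : MemLp χ ∞ surf := (BoundedContinuousFunction.mkOfCompact ⟨χ, hχ⟩).memLp_top
    -- With `χ - Hχ = Hφ`, one gets `(φ + χ) - H(φ + χ) = φ`.
    refine ⟨φ + hχm.toLp χ, Lp.ext ?_⟩
    have hs : scatteringOp k (hχm.toLp χ) =ᵐ[surf] scatter k χ := by
      rw [← scatter_congr_ae k hχm.coeFn_toLp]
      exact coeFn_scatteringOp k _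
    simp only [map_add]
    filter_upwards [Lp.coeFn_sub (φ + hχm.toLp χ)
      (scatteringOp k φ + scatteringOp k (hχm.toLp χ)), Lp.coeFn_add φ (hχm.toLp χ),
      Lp.coeFn_add (scatteringOp k φ) (scatteringOp k (hχm.toLp χ)), hχm.coeFn_toLp, hs,
      coeFn_scatteringOp k φ] with n h1 h2 h3 h4 h5 h6
    rw [h1, Pi.sub_apply, h2, h3, Pi.add_apply, Pi.add_apply, h4, h5, h6, ← h n]
    ring

end Range

/-! ### Fixed points on the product space -/

section Product

variable {Ω : Set R3}

/-- Lebesgue measure on the parameter space `Ω × [0, ∞)`. -/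
noncomputable abbrev paramMeasure (Ω : Set R3) : Measure (Ω × ℝ≥0) :=
  ((volume : Measure R3).comap ((↑) : Ω → R3)).prod ((volume : Measure ℝ).comap ((↑) : ℝ≥0 → ℝ))

lemma sFinite_paramMeasure (hΩ : IsOpen Ω) : SFinite (paramMeasure Ω) := by
  have h1 : IsFiniteMeasureOnCompacts ((volume : Measure R3).comap ((↑) : Ω → R3)) :=
    .comap' _ continuous_subtype_val (MeasurableEmbedding.subtype_coe hΩ.measurableSet)
  have h2 : IsFiniteMeasureOnCompacts ((volume : Measure ℝ).comap ((↑) : ℝ≥0 → ℝ)) :=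
    .comap' _ NNReal.continuous_coe (MeasurableEmbedding.subtype_coe measurableSet_Ici)
  have : LocallyCompactSpace Ω := hΩ.locallyCompactSpace
  infer_instance

/-- The factors are swapped so that the parameter is outermost: almost every parameter then has its
own null set of directions. -/
lemma ae_ae_of_ae_prodMeasure (hΩ : IsOpen Ω) {p : S2 × Ω × ℝ≥0 → Prop}
    (h : ∀ᵐ z ∂prodMeasure Ω, p z) : ∀ᵐ y ∂paramMeasure Ω, ∀ᵐ n ∂surf, p (n, y) := by
  have := sFinite_paramMeasure hΩ
  have hswap : Measure.QuasiMeasurePreserving Prod.swap ((paramMeasure Ω).prod surf)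
      (prodMeasure Ω) := Measure.measurePreserving_swap.quasiMeasurePreserving
  exact Measure.ae_ae_of_ae_prod (hswap.ae h)

lemma exists_const_representative (hΩ : IsOpen Ω) (K : C(S2 × S2 × Ω × ℝ≥0, ℝ))
    (hrot : ∀ (x : Ω) (ν : ℝ≥0), RotationInvariant (slice K x ν))
    (hnonneg : ∀ (x : Ω) (ν : ℝ≥0), NonNegative (slice K x ν))
    (hnorm : ∀ (x : Ω) (ν : ℝ≥0), Normalised (slice K x ν))
    (φ : Lp ℝ ∞ (prodMeasure Ω)) (hφ : scatterFull K φ =ᵐ[prodMeasure Ω] φ) :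
    ∃ g : S2 × Ω × ℝ≥0 → ℝ, φ =ᵐ[prodMeasure Ω] g ∧
      ∀ (x : Ω) (ν : ℝ≥0), Continuous (fun n => g (n, x, ν)) ∧ ∃ c : ℝ, ∀ n, g (n, x, ν) = c := by
  classical
  have := sFinite_paramMeasure hΩ
  have hbound : ∀ᵐ z ∂prodMeasure Ω, ‖φ z‖ ≤ ‖φ‖ := by
    filter_upwards [ae_le_eLpNormEssSup (f := φ) (μ := prodMeasure Ω)] with z hz
    rw [Lp.norm_def, eLpNorm_exponent_top, ← toReal_enorm]
    refine ENNReal.toReal_mono ?_ hz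
    rw [← eLpNorm_exponent_top]
    exact (Lp.memLp φ).eLpNorm_ne_top
  -- `G` collects the parameters where `H[φ]` is constant in direction; setting `g` to zero off `G`
  -- makes `g` constant in `n` for every parameter, and almost every parameter lies in `G`.
  let G : Set (Ω × ℝ≥0) := {y | ∃ c, ∀ n, scatterFull K φ (n, y) = c}
  have hG : ∀ᵐ y ∂paramMeasure Ω, y ∈ G := by
    filter_upwards [ae_ae_of_ae_prodMeasure hΩ hbound, ae_ae_of_ae_prodMeasure hΩ hφ]
      with y hb hy
    have hmeas : StronglyMeasurable fun n => φ (n, y) :=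
      (Lp.stronglyMeasurable φ).comp_measurable measurable_prodMk_right
    have hint : Integrable (fun n => φ (n, y)) surf :=
      Integrable.of_bound hmeas.aestronglyMeasurable _ hb
    refine const_of_ae_fixed (hrot y.1 y.2) (hnonneg y.1 y.2) (hnorm y.1 y.2) hint ?_
    filter_upwards [hy] with n hn using hn.symm
  have hG' : ∀ᵐ z ∂prodMeasure Ω, z.2 ∈ G :=
    (Measure.quasiMeasurePreserving_snd (μ := surf) (ν := paramMeasure Ω)).ae hG
  refine ⟨fun z => if z.2 ∈ G then scatterFull K φ z else 0, ?_, fun x ν => ?_⟩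
  · filter_upwards [hφ, hG'] with z hz hzG
    rw [if_pos hzG, hz]
  · have hc : ∃ c : ℝ, ∀ n : S2, (if (x, ν) ∈ G then scatterFull K φ (n, x, ν) else 0) = c := by
      by_cases h : (x, ν) ∈ G
      · obtain ⟨c, hc⟩ := id h
        exact ⟨c, fun n => by rw [if_pos h, hc]⟩
      · exact ⟨0, fun n => if_neg h⟩
    refine ⟨?_, hc⟩
    obtain ⟨c, hc⟩ := hc
    simp only [hc]
    exact continuous_const

end Product

end Scattering

theorem proposition2p2 (Ω : Set R3) (hΩ : IsOpen Ω) (K : C(S2 × S2 × Ω × ℝ≥0, ℝ))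
    (hrot : ∀ (x : Ω) (ν : ℝ≥0), RotationInvariant (slice K x ν))
    (hnonneg : ∀ (x : Ω) (ν : ℝ≥0), NonNegative (slice K x ν))
    (hnorm : ∀ (x : Ω) (ν : ℝ≥0), Normalised (slice K x ν)) :
    -- any two directions are joined by a finite chain along which the kernel is positive
    (∀ (x : Ω) (ν : ℝ≥0) (n ω : S2), JoinedByChain (slice K x ν) n ω) ∧
    -- fixed points on the product space, as classes modulo null sets
    (∀ φ : Lp ℝ ∞ (prodMeasure Ω), scatterFull K φ =ᵐ[prodMeasure Ω] φ →
      ∃ g : S2 × Ω × ℝ≥0 → ℝ, φ =ᵐ[prodMeasure Ω] g ∧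
        ∀ (x : Ω) (ν : ℝ≥0), Continuous (fun n => g (n, x, ν)) ∧
          ∃ c : ℝ, ∀ n, g (n, x, ν) = c) ∧
    -- functions whose sections are fixed points at every single direction and parameter
    (∀ φ : S2 × Ω × ℝ≥0 → ℝ,
      (∀ (x : Ω) (ν : ℝ≥0), MemLp (fun n => φ (n, x, ν)) ∞ surf) →
      (∀ p, scatterFull K φ p = φ p) →
        ∀ (x : Ω) (ν : ℝ≥0), Continuous (fun n => φ (n, x, ν)) ∧
          ∃ c : ℝ, ∀ n, φ (n, x, ν) = c) ∧
    -- fixed points of the operator at each single pair of parameters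
    (∀ (x : Ω) (ν : ℝ≥0) (φ : Lp ℝ ∞ surf), scatteringOp (slice K x ν) φ = φ →
      ∃ g : S2 → ℝ, φ =ᵐ[surf] g ∧ Continuous g ∧ ∃ c : ℝ, ∀ n, g n = c) ∧
    -- the range of the identity minus the operator, at each pair of parameters
    (∀ (x : Ω) (ν : ℝ≥0),
      Set.range (fun ψ : Lp ℝ ∞ surf => ψ - scatteringOp (slice K x ν) ψ) =
        {φ : Lp ℝ ∞ surf | ∫ n, φ n ∂surf = 0}) := by
  refine ⟨fun x ν => joinedByChain (hrot x ν) (hnorm x ν),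
    exists_const_representative hΩ K hrot hnonneg hnorm, ?_, ?_,
    fun x ν => range_sub_scatteringOp (hrot x ν) (hnonneg x ν) (hnorm x ν)⟩
  · intro φ hφ hfix x ν
    have hint : Integrable (fun n => φ (n, x, ν)) surf := (hφ x ν).integrable le_top
    have heq : scatter (slice K x ν) (fun n => φ (n, x, ν)) = fun n => φ (n, x, ν) :=
      funext fun n => hfix (n, x, ν)
    have hcont : Continuous fun n => φ (n, x, ν) := heq ▸ continuous_scatter _ hint
    exact ⟨hcont, const_of_continuous_fixed (hrot x ν) (hnonneg x ν) (hnorm x ν) hcont heq⟩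
  · intro x ν φ hfix
    have hae : φ =ᵐ[surf] scatter (slice K x ν) φ := by
      conv_lhs => rw [← hfix]
      exact coeFn_scatteringOp _ φ
    exact ⟨_, hae, continuous_scatter _ (integrable_of_Linfty φ),
      const_of_ae_fixed (hrot x ν) (hnonneg x ν) (hnorm x ν) (integrable_of_Linfty φ) hae⟩
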